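/- For a compact Hausdorff space $X$ let $C(X)$ be the space of continuous complex-valued functions on $X$, let $\rho(f)=\sup\{|f(x)-f(z)| : x,z\in X\}$ for $f\in C(X)$, let $C_\rho(X)=C(X)/\ker\rho$ where $\ker\rho=\{f:\rho(f)=0\}$, with quotient map $\pi_X\colon C(X)\to C_\rho(X)$ and the norm $\|\pi_X(f)\|_\rho=\rho(f)$. A map $T\colon C_\rho(X)\to C_\rho(Y)$ (not assumed to be linear, continuous or surjective) is a 2-local isometry if for all $e,u\in C_\rho(X)$ there is a surjective linear isometry $S\colon C_\rho(X)\to C_\rho(Y)$ with $S(e)=T(e)$ and $S(u)=T(u)$. A map $\Delta\colon C(X)\to C(Y)$ is diameter-preserving if $\rho(\Delta(f)-\Delta(g))=\rho(f-g)$ for all $f,g\in C(X)$; it is 2-local diameter-preserving if for all $f,g\in C(X)$ there is a diameter-preserving linear bijection $S\colon C(X)\to C(Y)$ with $S(f)=\Delta(f)$ and $S(g)=\Delta(g)$. Theorem. Let $X$ and $Y$ be non-empty first countable compact Hausdorff spaces. (1) Every 2-local isometry $T\colon C_\rho(X)\to C_\rho(Y)$ is a surjective linear isometry. Moreover, there are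 $\lambda\in\mathbb{C}$ with $|\lambda|=1$ and a homeomorphism $\varphi\colon Y\to X$ such that $T(\pi_X(f))=\pi_Y(\lambda\, f\circ\varphi)$ for all $f\in C(X)$. (2) For every 2-local diameter-preserving map $\Delta\colon C(X)\to C(Y)$ there are $\lambda\in\mathbb{C}$ with $|\lambda|=1$, a homeomorphism $\varphi\colon Y\to X$ and a homogeneous functional $\mu\colon C(X)\to\mathbb{C}$ (that is, $\mu(af)=a\mu(f)$ for all $a\in\mathbb{C}$ and $f\in C(X)$; $\mu$ need not be additive) with $\mu(1_X)\neq-\lambda$, such that $\Delta(f)=\lambda\, f\circ\varphi+\mu(f)1_Y$ for all $f\in C(X)$. -/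

import Mathlib

namespace DiameterNorm

noncomputable section

/-- The diameter of the range: `ρ(f) = sup {|f(x) - f(z)| : x, z ∈ X}`. -/
def rho {X : Type*} [TopologicalSpace X] (f : C(X, ℂ)) : ℝ :=
  ⨆ p : X × X, ‖f p.1 - f p.2‖

section Basic

variable {X : Type*} [TopologicalSpace X]

theorem rho_nonneg (f : C(X, ℂ)) : 0 ≤ rho f :=
  Real.iSup_nonneg fun _ => norm_nonneg _

theorem rho_smul (c : ℂ) (f : C(X, ℂ)) : rho (c • f) = ‖c‖ * rho f := by
  unfold rho
  rw [Real.mul_iSup_of_nonneg (norm_nonneg c)]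
  congr 1
  funext p
  rw [← norm_mul]
  simp [mul_sub]

variable [CompactSpace X]

theorem bddAbove_rho (f : C(X, ℂ)) :
    BddAbove (Set.range fun p : X × X => ‖f p.1 - f p.2‖) := by
  have h : Continuous fun p : X × X => ‖f p.1 - f p.2‖ := by fun_prop
  exact (isCompact_range h).bddAbove

theorem norm_sub_le_rho (f : C(X, ℂ)) (x z : X) : ‖f x - f z‖ ≤ rho f :=
  le_ciSup (bddAbove_rho f) (x, z)

theorem rho_add_le (f g : C(X, ℂ)) : rho (f + g) ≤ rho f + rho g := by
  refine Real.iSup_le (fun p => ?_) (add_nonneg (rho_nonneg f) (rho_nonneg g))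
  have h : (f + g) p.1 - (f + g) p.2 = (f p.1 - f p.2) + (g p.1 - g p.2) := by
    simp only [ContinuousMap.add_apply]
    ring
  rw [h]
  exact (norm_add_le _ _).trans
    (add_le_add (norm_sub_le_rho f p.1 p.2) (norm_sub_le_rho g p.1 p.2))

theorem rho_zero : rho (0 : C(X, ℂ)) = 0 := by
  simpa using rho_smul (0 : ℂ) (0 : C(X, ℂ))

theorem rho_neg (f : C(X, ℂ)) : rho (-f) = rho f := by
  simpa using rho_smul (-1 : ℂ) f

end Basic

variable (X : Type*) [TopologicalSpace X] [CompactSpace X]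

/-- The subspace `ker ρ = {f : ρ(f) = 0}` of `C(X)`. -/
def kerRho : Submodule ℂ C(X, ℂ) where
  carrier := {f | rho f = 0}
  zero_mem' := rho_zero
  add_mem' := fun {f g} hf hg => by
    have hf : rho f = 0 := hf
    have hg : rho g = 0 := hg
    have h := rho_add_le f g
    rw [hf, hg, add_zero] at h
    exact le_antisymm h (rho_nonneg _)
  smul_mem' := fun c f hf => by
    have hf : rho f = 0 := hf
    change rho (c • f) = 0
    rw [rho_smul, hf, mul_zero]

/-- The quotient vector space `C_ρ(X) = C(X) / ker ρ`. It carries the diameter norm below, not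
the quotient norm of the supremum norm. -/
def CRho : Type _ := C(X, ℂ) ⧸ kerRho X

instance : AddCommGroup (CRho X) := inferInstanceAs (AddCommGroup (C(X, ℂ) ⧸ kerRho X))

instance : Module ℂ (CRho X) := inferInstanceAs (Module ℂ (C(X, ℂ) ⧸ kerRho X))

/-- The canonical quotient map `π_X : C(X) → C_ρ(X)`. -/
def proj : C(X, ℂ) →ₗ[ℂ] CRho X := (kerRho X).mkQ

theorem proj_surjective : Function.Surjective (proj X) := (kerRho X).mkQ_surjective

variable {X}

theorem proj_eq_proj_iff (f g : C(X, ℂ)) : proj X f = proj X g ↔ rho (f - g) = 0 :=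
  Submodule.Quotient.eq (kerRho X)

theorem rho_eq_of_rho_sub {f g : C(X, ℂ)} (h : rho (f - g) = 0) : rho f = rho g := by
  have h' : rho (g - f) = 0 := by rw [← neg_sub, rho_neg, h]
  have h1 := rho_add_le (f - g) g
  have h2 := rho_add_le (g - f) f
  rw [sub_add_cancel, h, zero_add] at h1
  rw [sub_add_cancel, h', zero_add] at h2
  exact le_antisymm h1 h2

variable (X)

/-- The diameter norm `‖π_X(f)‖_ρ = ρ(f)`. -/
instance : Norm (CRho X) where
  norm := fun e => Quotient.liftOn' (s₁ := (kerRho X).quotientRel) e rho fun _ _ h =>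
    rho_eq_of_rho_sub ((Submodule.quotientRel_def (kerRho X)).1 h)

theorem norm_proj (f : C(X, ℂ)) : ‖proj X f‖ = rho f := rfl

theorem normCore : NormedSpace.Core ℂ (CRho X) where
  norm_nonneg := fun e => by
    obtain ⟨f, rfl⟩ := proj_surjective X e
    exact rho_nonneg f
  norm_smul := fun c e => by
    obtain ⟨f, rfl⟩ := proj_surjective X e
    rw [← map_smul, norm_proj, norm_proj, rho_smul]
  norm_triangle := fun e u => by
    obtain ⟨f, rfl⟩ := proj_surjective X e
    obtain ⟨g, rfl⟩ := proj_surjective X u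
    rw [← map_add, norm_proj, norm_proj, norm_proj]
    exact rho_add_le f g
  norm_eq_zero_iff := fun e => by
    obtain ⟨f, rfl⟩ := proj_surjective X e
    rw [norm_proj, ← map_zero (proj X), proj_eq_proj_iff, sub_zero]

instance : NormedAddCommGroup (CRho X) := NormedAddCommGroup.ofCore (normCore X)

instance : NormedSpace ℂ (CRho X) := NormedSpace.ofCore (normCore X)

variable {X} {Y : Type*} [TopologicalSpace Y] [CompactSpace Y]

/-- `T : C_ρ(X) → C_ρ(Y)` is a 2-local isometry: at any two vectors it agrees with some
surjective linear isometry. No linearity, continuity or surjectivity of `T` is required. -/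
def IsTwoLocalIsometry (T : CRho X → CRho Y) : Prop :=
  ∀ e u : CRho X, ∃ S : CRho X ≃ₗᵢ[ℂ] CRho Y, S e = T e ∧ S u = T u

/-- `Δ : C(X) → C(Y)` is diameter-preserving: `ρ(Δ(f) - Δ(g)) = ρ(f - g)`. -/
def IsDiameterPreserving (Δ : C(X, ℂ) → C(Y, ℂ)) : Prop :=
  ∀ f g : C(X, ℂ), rho (Δ f - Δ g) = rho (f - g)

/-- `Δ : C(X) → C(Y)` is a 2-local diameter-preserving map: at any two functions it agrees with
some diameter-preserving linear bijection. -/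
def IsTwoLocalDiameterPreserving (Δ : C(X, ℂ) → C(Y, ℂ)) : Prop :=
  ∀ f g : C(X, ℂ), ∃ S : C(X, ℂ) ≃ₗ[ℂ] C(Y, ℂ),
    IsDiameterPreserving S ∧ S f = Δ f ∧ S g = Δ g

end

end DiameterNorm

/-! Linear isometries are read through the functionals δ_x − δ_z, the "edges" of X. First
countability supplies a function whose diameter is attained only at {x, z}. Its image attains its
diameter at some edge of Y, and the pullback of that edge must be a unimodular multiple of δ_x − δ_z
(`exists_evalDiff_comp`). Relations among edges then force a single vertex map and a single factor
(`exists_center`, `exists_vertexMap`), so every surjective linear isometry is a weighted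
composition.

A 2-local isometry T is thus, on each pair of functions, given by one weight and one homeomorphism.
If X has three points, a test function with values on a parabolic arc fixes the weight once and for
all (`exists_weight`). With the weight fixed, compatibility with real-linear functionals
(`apply_compReal`) makes f ↦ f ∘ φ_f, at each point of Y, an additive functional on C(X, ℝ) that
respects squares and takes a value of f. Such a functional is a point evaluation (`exists_eq_eval`),
and these points assemble into one homeomorphism. Spaces with at most two points give dimension at
most one, where T is determined by one vector.

A 2-local diameter-preserving Δ descends to a 2-local isometry; μ records the constants lost in the
quotient. -/

namespace DiameterNorm

/-- A real function viewed as a complex one. -/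
noncomputable def toComplex {X : Type*} [TopologicalSpace X] (f : C(X, ℝ)) : C(X, ℂ) := ⟨fun x => (f x : ℂ), by fun_prop⟩

@[simp]
theorem toComplex_apply {X : Type*} [TopologicalSpace X] (f : C(X, ℝ)) (x : X) : toComplex f x = (f x : ℂ) := rfl

/-! ### Separating and peaking functions -/

section Urysohn

variable {X : Type*} [TopologicalSpace X] [CompactSpace X] [T2Space X]

theorem exists_eq_one_eq_zero_on {x : X} {s : Set X} (hs : IsClosed s) (hx : x ∉ s) :
    ∃ f : C(X, ℝ), f x = 1 ∧ (∀ z ∈ s, f z = 0) ∧ ∀ z, f z ∈ Set.Icc (0 : ℝ) 1 := by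
  obtain ⟨f, h0, h1, h⟩ := exists_continuous_zero_one_of_isClosed hs
    (isClosed_singleton (x := x)) (Set.disjoint_singleton_right.2 hx)
  exact ⟨f, h1 rfl, fun z hz => h0 hz, h⟩

theorem exists_complex_eq_one_eq_zero_on {x : X} {s : Set X} (hs : IsClosed s) (hx : x ∉ s) :
    ∃ f : C(X, ℂ), f x = 1 ∧ ∀ z ∈ s, f z = 0 := by
  obtain ⟨f, h1, h0, -⟩ := exists_eq_one_eq_zero_on hs hx
  exact ⟨toComplex f, by simp [h1], fun z hz => by simp [h0 z hz]⟩

theorem exists_complex_bump (x : X) (s : Set X) (hs : s.Finite) :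
    ∃ f : C(X, ℂ), f x = 1 ∧ ∀ z ∈ s, z ≠ x → f z = 0 := by
  obtain ⟨f, h1, h0⟩ := exists_complex_eq_one_eq_zero_on (x := x) (s := s \ {x})
    (hs.subset Set.sdiff_subset).isClosed (by simp)
  exact ⟨f, h1, fun z hz hzx => h0 z ⟨hz, hzx⟩⟩

/-- First countability makes {x} a Gδ set, which is what allows the value 1 to be taken only at x.
-/
theorem exists_peak [FirstCountableTopology X] (x : X) {s : Set X} (hs : IsClosed s)
    (hx : x ∉ s) :
    ∃ f : C(X, ℝ), (∀ z, f z = 1 ↔ z = x) ∧ (∀ z ∈ s, f z = 0) ∧ ∀ z, f z ∈ Set.Icc (0 : ℝ) 1 := by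
  obtain ⟨f, h1, h0, -, h⟩ := exists_continuous_one_zero_of_isCompact_of_isGδ
    (isCompact_singleton (x := x)) (IsGδ.singleton x) hs (Set.disjoint_singleton_left.2 hx)
  refine ⟨f, fun z => ?_, fun z hz => h0 hz, h⟩
  have : z ∈ ({x} : Set X) ↔ z ∈ f ⁻¹' {1} := by rw [← h1]
  simpa using this.symm

/-- A function whose diameter is attained exactly at one pair of points. -/
theorem exists_peak_pair [FirstCountableTopology X] {x z : X} (hxz : x ≠ z) :
    ∃ u : C(X, ℝ), u x = 1 ∧ u z = -1 ∧ (∀ p, |u p| ≤ 1) ∧ ∀ p, |u p| = 1 → p = x ∨ p = z := by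
  obtain ⟨f, f1, f0, hf⟩ := exists_peak x (isClosed_singleton (x := z)) (by simpa using hxz)
  obtain ⟨g, g1, g0, hg⟩ := exists_peak z (isClosed_singleton (x := x)) (by simpa using hxz.symm)
  -- Both peaks take values in [0, 1], so f − g = ±1 forces f = 1 or g = 1.
  refine ⟨f - g, ?_, ?_, fun p => ?_, fun p hp => ?_⟩
  · simp [(f1 x).2 rfl, g0 x rfl]
  · simp [(g1 z).2 rfl, f0 z rfl]
  · have h1 := hf p
    have h2 := hg p
    simp only [Set.mem_Icc] at h1 h2
    rw [ContinuousMap.sub_apply, abs_le]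
    constructor <;> linarith
  · have h1 := hf p
    have h2 := hg p
    simp only [Set.mem_Icc] at h1 h2
    rw [ContinuousMap.sub_apply] at hp
    rcases (abs_eq zero_le_one).1 hp with h | h
    · exact Or.inl ((f1 p).1 (by linarith))
    · exact Or.inr ((g1 p).1 (by linarith))

theorem continuous_of_comp {Y : Type*} [TopologicalSpace Y] {φ : Y → X}
    (h : ∀ f : C(X, ℝ), Continuous fun y => f (φ y)) : Continuous φ := by
  refine continuous_iff_continuousAt.2 fun y U hU => ?_
  obtain ⟨V, hVU, hV, hy⟩ := mem_nhds_iff.1 hU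
  obtain ⟨f, f1, f0, -⟩ := exists_eq_one_eq_zero_on (x := φ y) hV.isClosed_compl (by simpa using hy)
  have hW : {y' | 0 < f (φ y')} ∈ nhds y :=
    (isOpen_lt continuous_const (h f)).mem_nhds (by simp [f1])
  refine Filter.mem_map.2 ?_
  filter_upwards [hW] with y' hy'
  refine hVU ?_
  by_contra hn
  exact (ne_of_gt hy') (f0 _ hn)

end Urysohn

theorem rho_le {X : Type*} [TopologicalSpace X] {f : C(X, ℂ)} {r : ℝ} [Nonempty X] (h : ∀ x z, ‖f x - f z‖ ≤ r) : rho f ≤ r :=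
  ciSup_le fun p => h p.1 p.2

/-! ### Evaluation differences as functionals on C_ρ(X) -/

section EvalDiff

variable {X : Type*} [TopologicalSpace X] [CompactSpace X]

/-- The functional `π(f) ↦ f(x) - f(z)` on `C_ρ(X)`. -/
noncomputable def evalDiff (x z : X) : CRho X →ₗ[ℂ] ℂ :=
  (kerRho X).liftQ
    { toFun := fun f => f x - f z
      map_add' := fun f g => by simp only [ContinuousMap.add_apply]; ring
      map_smul' := fun c f => by
        simp only [ContinuousMap.smul_apply, smul_eq_mul, RingHom.id_apply]; ring }
    fun f hf => by
      have hf : rho f = 0 := hf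
      have h := norm_sub_le_rho f x z
      rw [hf] at h
      exact norm_le_zero_iff.1 h

@[simp]
theorem evalDiff_proj (x z : X) (f : C(X, ℂ)) : evalDiff x z (proj X f) = f x - f z := rfl

theorem norm_evalDiff_le (x z : X) (e : CRho X) : ‖evalDiff x z e‖ ≤ ‖e‖ := by
  obtain ⟨f, rfl⟩ := proj_surjective X e
  exact norm_sub_le_rho f x z

theorem exists_norm_evalDiff_eq [Nonempty X] (e : CRho X) : ∃ x z, ‖evalDiff x z e‖ = ‖e‖ := by
  obtain ⟨f, rfl⟩ := proj_surjective X e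
  have hc : Continuous fun p : X × X => ‖f p.1 - f p.2‖ := by fun_prop
  obtain ⟨p, -, hp⟩ := isCompact_univ.exists_isMaxOn Set.univ_nonempty hc.continuousOn
  refine ⟨p.1, p.2, le_antisymm (norm_evalDiff_le _ _ _) ?_⟩
  exact rho_le fun x z => hp (Set.mem_univ (x, z))

theorem proj_eq_iff_forall [Nonempty X] {f g : C(X, ℂ)} :
    proj X f = proj X g ↔ ∀ x z, f x - f z = g x - g z := by
  constructor
  · intro h x z
    rw [← evalDiff_proj, h, evalDiff_proj]
  · intro h
    rw [proj_eq_proj_iff]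
    refine le_antisymm (rho_le fun x z => ?_) (rho_nonneg _)
    rw [norm_le_zero_iff, ContinuousMap.sub_apply, ContinuousMap.sub_apply]
    linear_combination h x z

theorem proj_eq_iff [Nonempty X] {f g : C(X, ℂ)} :
    proj X f = proj X g ↔ ∃ a : ℂ, ∀ x, f x = g x + a := by
  rw [proj_eq_iff_forall]
  constructor
  · intro h
    obtain ⟨z⟩ := ‹Nonempty X›
    exact ⟨f z - g z, fun x => by linear_combination h x z⟩
  · rintro ⟨a, ha⟩ x z
    rw [ha, ha]
    ring

end EvalDiff

/-! ### Isometries carry edges to edges -/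

section Dual

variable {X Y : Type*} [TopologicalSpace X] [CompactSpace X] [TopologicalSpace Y] [CompactSpace Y]

theorem eq_zero_of_norm_add_mul_le {L : ℂ}
    (h : ∀ ε > 0, ∃ M : ℝ, 0 ≤ M ∧ ∀ w : ℂ, ‖w‖ = 1 → ‖(M : ℂ) + w * L‖ ≤ M + ε) : L = 0 := by
  by_contra hL
  have hpos : 0 < ‖L‖ := norm_pos_iff.2 hL
  obtain ⟨M, hM, hw⟩ := h (‖L‖ / 2) (half_pos hpos)
  have hne : (‖L‖ : ℂ) ≠ 0 := by exact_mod_cast hpos.ne'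
  have h1 := hw ((‖L‖ : ℂ) / L) (by rw [norm_div, Complex.norm_real, norm_norm, div_self hpos.ne'])
  rw [div_mul_cancel₀ _ hL, ← Complex.ofReal_add, Complex.norm_real, Real.norm_eq_abs,
    abs_of_nonneg (by positivity)] at h1
  linarith

/-- A functional dominated by the diameter norm that attains it on a function peaking at a pair
vanishes on the functions vanishing at this pair. -/
theorem eq_zero_of_peak_pair [Nonempty X] (L : CRho X →ₗ[ℂ] ℂ) (hL : ∀ e, ‖L e‖ ≤ ‖e‖) {x z : X}
    {u : C(X, ℝ)} (hu : ∀ p, |u p| ≤ 1) (hp : ∀ p, |u p| = 1 → p = x ∨ p = z)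
    (hLu : L (proj X (toComplex u)) = 2) {f : C(X, ℂ)} (hx : f x = 0) (hz : f z = 0) :
    L (proj X f) = 0 := by
  refine eq_zero_of_norm_add_mul_le fun ε hε => ?_
  have hK : IsCompact {p | ε / 2 ≤ ‖f p‖} :=
    (isClosed_le continuous_const (by fun_prop)).isCompact
  -- On the compact set where f is not small, x and z are absent and so |u| < 1. A large multiple of
  -- 1 − |u| therefore dominates |f|, and N u + w f has sup norm at most N + ε/2 for every
  -- unimodular w.
  obtain ⟨N, hN0, hN⟩ : ∃ N : ℝ, 0 ≤ N ∧ ∀ p, ε / 2 ≤ ‖f p‖ → ‖f p‖ ≤ N * (1 - |u p|) := by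
    have hc : ContinuousOn (fun p => ‖f p‖ / (1 - |u p|)) {p | ε / 2 ≤ ‖f p‖} := by
      refine ContinuousOn.div (by fun_prop) (by fun_prop) fun p hpf h0 => ?_
      have hpf : ε / 2 ≤ ‖f p‖ := hpf
      rcases hp p (by linarith) with rfl | rfl
      · rw [hx, norm_zero] at hpf; linarith
      · rw [hz, norm_zero] at hpf; linarith
    obtain ⟨N, hN⟩ := hK.bddAbove_image hc
    refine ⟨max N 0, le_max_right _ _, fun p hpf => ?_⟩
    have h1 : ‖f p‖ / (1 - |u p|) ≤ max N 0 := (hN ⟨p, hpf, rfl⟩).trans (le_max_left _ _)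
    have h2 : 0 < 1 - |u p| := by
      refine lt_of_le_of_ne (by linarith [hu p]) fun h0 => ?_
      rcases hp p (by linarith) with rfl | rfl
      · rw [hx, norm_zero] at hpf; linarith
      · rw [hz, norm_zero] at hpf; linarith
    rwa [div_le_iff₀ h2] at h1
  refine ⟨2 * N, by positivity, fun w hw => ?_⟩
  have hval : ((2 * N : ℝ) : ℂ) + w * L (proj X f)
      = L (proj X ((N : ℂ) • toComplex u + w • f)) := by
    rw [map_add, map_smul, map_smul, map_add, map_smul, map_smul, hLu]
    simp only [smul_eq_mul]
    push_cast
    ring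
  rw [hval]
  refine (hL _).trans ?_
  rw [norm_proj]
  have hb : ∀ p, ‖((N : ℂ) • toComplex u + w • f) p‖ ≤ N + ε / 2 := by
    intro p
    have h1 : ‖((N : ℂ) • toComplex u + w • f) p‖ ≤ N * |u p| + ‖f p‖ := by
      refine (norm_add_le _ _).trans (le_of_eq ?_)
      simp [hw, abs_of_nonneg hN0, Complex.norm_real]
    by_cases hpf : ε / 2 ≤ ‖f p‖
    · have := hN p hpf
      nlinarith
    · have := mul_le_mul_of_nonneg_left (hu p) hN0
      linarith
  refine rho_le fun p q => ?_
  refine (norm_sub_le _ _).trans ?_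
  linarith [hb p, hb q]

/-- The peaking function u has norm 2, attained by its image at some (y, w). Rescaled, the
pulled-back functional is dominated by the norm and equals 2 at u, so it kills every function
vanishing at x and z. -/
theorem exists_evalDiff_comp [T2Space X] [FirstCountableTopology X] [Nonempty Y]
    (S : CRho X →ₗᵢ[ℂ] CRho Y) {x z : X} (hxz : x ≠ z) :
    ∃ (y w : Y) (a : ℂ), ‖a‖ = 1 ∧ ∀ e, evalDiff y w (S e) = a * evalDiff x z e := by
  have : Nonempty X := ⟨x⟩
  obtain ⟨u, ux, uz, hu, hp⟩ := exists_peak_pair hxz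
  have hnorm : ‖proj X (toComplex u)‖ = 2 := by
    refine le_antisymm (rho_le fun p q => ?_) ?_
    · rw [toComplex_apply, toComplex_apply, ← Complex.ofReal_sub, Complex.norm_real,
        Real.norm_eq_abs, abs_le]
      have h1 := abs_le.1 (hu p)
      have h2 := abs_le.1 (hu q)
      constructor <;> linarith
    · refine le_trans (le_of_eq ?_) (norm_evalDiff_le x z (proj X (toComplex u)))
      rw [evalDiff_proj, toComplex_apply, toComplex_apply, ux, uz]
      norm_num
  obtain ⟨y, w, hyw⟩ := exists_norm_evalDiff_eq (S (proj X (toComplex u)))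
  rw [S.norm_map, hnorm] at hyw
  set d := evalDiff y w (S (proj X (toComplex u))) with hd
  have hd0 : d ≠ 0 := fun h => by simp [h] at hyw
  refine ⟨y, w, d / 2, by rw [norm_div, hyw]; simp, fun e => ?_⟩
  let L : CRho X →ₗ[ℂ] ℂ := (2 / d) • (evalDiff y w ∘ₗ S.toLinearMap)
  have hLe : ∀ e, L e = 2 / d * evalDiff y w (S e) := fun e => rfl
  have hL : ∀ e, ‖L e‖ ≤ ‖e‖ := fun e => by
    rw [hLe, norm_mul, norm_div, hyw]
    simpa using norm_evalDiff_le y w (S e)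
  have hLu : L (proj X (toComplex u)) = 2 := by
    rw [hLe, ← hd, div_mul_cancel₀ _ hd0]
  obtain ⟨f, rfl⟩ := proj_surjective X e
  have hone : proj X (ContinuousMap.const X ((f x + f z) / 2)) = 0 := by
    rw [← map_zero (proj X), proj_eq_iff_forall]
    simp
  -- Subtracting the combination of u and a constant that interpolates f at x and z leaves a
  -- function vanishing at both.
  have h0 := eq_zero_of_peak_pair L hL hu hp hLu
    (f := f - ((f x - f z) / 2) • toComplex u - ContinuousMap.const X ((f x + f z) / 2))
    (by simp [ux]; ring) (by simp [uz]; ring)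
  rw [map_sub, map_sub, hone, map_zero, sub_zero, map_sub, map_smul, map_sub, map_smul, hLu, hLe] at h0
  rw [evalDiff_proj]
  simp only [smul_eq_mul] at h0
  field_simp at h0 ⊢
  linear_combination h0

end Dual

/-! ### Linear relations between edges -/

section Edges

variable {Y : Type*} [TopologicalSpace Y] [CompactSpace Y] [T2Space Y]

/-- A bump at y isolates the coefficient −α of δ_y on the right, so δ_y must also occur on the left.
-/
theorem mem_pair_of_forall_sub_eq {p q y w y' w' : Y} {α β : ℂ} (hα : α ≠ 0)
    (h : ∀ F : C(Y, ℂ), F p - F q = β * (F y' - F w') - α * (F y - F w))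
    (hyw : w ≠ y) (hy' : y' ≠ y) (hw' : w' ≠ y) : p = y ∨ q = y := by
  by_contra! hn
  obtain ⟨F, F1, F0⟩ := exists_complex_bump y {p, q, y', w', w} (Set.toFinite _)
  have := h F
  rw [F1, F0 p (by simp) hn.1, F0 q (by simp) hn.2, F0 y' (by simp) hy', F0 w' (by simp) hw',
    F0 w (by simp) hyw] at this
  apply hα
  linear_combination this

/-- Two edges whose difference is again an edge have a common vertex. -/
theorem exists_common_vertex {p q y w y' w' : Y} {α β : ℂ} (hα : α ≠ 0) (hβ : β ≠ 0)
    (h : ∀ F : C(Y, ℂ), F p - F q = β * (F y' - F w') - α * (F y - F w))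
    (hyw : y ≠ w) (hyw' : y' ≠ w') : y' = y ∨ w' = y ∨ y' = w ∨ w' = w := by
  by_contra! hn
  obtain ⟨h1, h2, h3, h4⟩ := hn
  -- For disjoint edges the three distinct points y, w, y' would all lie in {p, q}.
  have hy := mem_pair_of_forall_sub_eq hα h hyw.symm h1 h2
  have hw := mem_pair_of_forall_sub_eq (y := w) (w := y) (β := β) (neg_ne_zero.2 hα)
    (fun F => by linear_combination h F : ∀ F : C(Y, ℂ), F p - F q = _) hyw h3 h4
  have hy' := mem_pair_of_forall_sub_eq (y := y') (w := w') (y' := y) (w' := w) (β := α) hβ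
    (fun F => by linear_combination -h F : ∀ F : C(Y, ℂ), F q - F p = _) hyw'.symm h1.symm h3.symm
  rcases hy with rfl | rfl <;> rcases hw with rfl | rfl <;> rcases hy' with rfl | rfl <;>
    simp_all

/-- Two edges with a common vertex whose difference is again an edge carry the same factor. -/
theorem eq_of_forall_sub_eq {p q y u u' : Y} {α β : ℂ} (hα : α ≠ 0) (hβ : β ≠ 0)
    (h : ∀ F : C(Y, ℂ), F p - F q = β * (F u' - F y) - α * (F u - F y))
    (hu : u ≠ y) (hu' : u' ≠ y) (huu : u ≠ u') : α = β := by
  have h1 := mem_pair_of_forall_sub_eq hα h hu.symm huu.symm hu.symm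
  have h2 := mem_pair_of_forall_sub_eq (y := u') (w := y) (y' := u) (w' := y) (β := α) hβ
    (fun F => by linear_combination -h F : ∀ F : C(Y, ℂ), F q - F p = _) hu'.symm huu hu'.symm
  -- Since {p, q} = {u, u'}, a bump at y kills the left side and leaves α − β on the right.
  obtain ⟨F, F1, F0⟩ := exists_complex_bump y {u, u'} (Set.toFinite _)
  have hF := h F
  have hu0 := F0 u (by simp) hu
  have hu0' := F0 u' (by simp) hu'
  have hpq : F p = 0 ∧ F q = 0 := by
    rcases h1 with rfl | rfl <;> rcases h2 with rfl | rfl <;> simp_all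
  rw [hpq.1, hpq.2, F1, hu0, hu0'] at hF
  linear_combination -hF

end Edges

/-! ### Surjective linear isometries are weighted compositions -/

section Isometry

variable {X Y : Type*} [TopologicalSpace X] [CompactSpace X]
  [TopologicalSpace Y] [CompactSpace Y]

theorem evalDiff_swap (x z : X) (e : CRho X) : evalDiff x z e = -evalDiff z x e := by
  obtain ⟨f, rfl⟩ := proj_surjective X e
  simp

theorem evalDiff_sub_evalDiff (x z v : X) (e : CRho X) :
    evalDiff x v e - evalDiff z v e = evalDiff x z e := by
  obtain ⟨f, rfl⟩ := proj_surjective X e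
  simp

/-- The edge `{x, z}` of `X` is carried to the edge `{y, w}` of `Y` with the factor `a`. -/
def MapsEdge (S : CRho X ≃ₗᵢ[ℂ] CRho Y) (x z : X) (y w : Y) (a : ℂ) : Prop :=
  ‖a‖ = 1 ∧ ∀ e, evalDiff y w (S e) = a * evalDiff x z e

variable {S : CRho X ≃ₗᵢ[ℂ] CRho Y} {x z : X} {y w : Y} {a : ℂ}

theorem MapsEdge.ne_zero (h : MapsEdge S x z y w a) : a ≠ 0 := by
  rintro rfl
  simpa using h.1

theorem MapsEdge.swap_right (h : MapsEdge S x z y w a) : MapsEdge S x z w y (-a) :=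
  ⟨by rw [norm_neg, h.1], fun e => by rw [evalDiff_swap, h.2]; ring⟩

theorem MapsEdge.ne [T2Space X] (h : MapsEdge S x z y w a) (hxz : x ≠ z) : y ≠ w := by
  rintro rfl
  obtain ⟨f, f1, f0⟩ := exists_complex_bump x {z} (Set.toFinite _)
  have h1 := h.2 (proj X f)
  rw [evalDiff_proj, f1, f0 z rfl hxz.symm] at h1
  obtain ⟨F, hF⟩ := proj_surjective Y (S (proj X f))
  rw [← hF, evalDiff_proj] at h1
  apply h.ne_zero
  linear_combination -h1

/-- This is δ_x' − δ_x = (δ_x' − δ_x₀) − (δ_x − δ_x₀) transported by S; surjectivity of S makes it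
hold for every F. -/
theorem MapsEdge.triangle {x₀ x x' : X} {y w y' w' p q : Y} {a a' b : ℂ}
    (h : MapsEdge S x x₀ y w a) (h' : MapsEdge S x' x₀ y' w' a') (hb : MapsEdge S x' x p q b)
    (F : C(Y, ℂ)) : F p - F q = b / a' * (F y' - F w') - b / a * (F y - F w) := by
  obtain ⟨e, he⟩ := S.surjective (proj Y F)
  have e1 := h.2 e
  have e2 := h'.2 e
  have e3 := hb.2 e
  rw [he, evalDiff_proj] at e1 e2 e3
  rw [e1, e2, e3, ← evalDiff_sub_evalDiff x' x x₀]
  have := h.ne_zero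
  have := h'.ne_zero
  field_simp

variable [T2Space X]

/-- An injective map of compact spaces that pulls back continuous functions to continuous functions,
and whose range is not contained in the zero set of a function taking the value `1`, is a
homeomorphism. -/
theorem exists_homeomorph (φ : Y → X)
    (hc : ∀ f : C(X, ℝ), Continuous fun y => f (φ y)) (hinj : Function.Injective φ)
    (hsurj : ∀ f : C(X, ℝ), (∀ y, f (φ y) = 0) → ∀ x, f x ≠ 1) : ∃ ψ : Y ≃ₜ X, ⇑ψ = φ := by
  have hφ : Continuous φ := continuous_of_comp hc
  have hs : Function.Surjective φ := by
    intro x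
    by_contra hx
    obtain ⟨f, f1, f0, -⟩ := exists_eq_one_eq_zero_on (isCompact_range hφ).isClosed hx
    exact hsurj f (fun y => f0 _ ⟨y, rfl⟩) x f1
  exact ⟨Continuous.homeoOfEquivCompactToT2 (f := Equiv.ofBijective φ ⟨hinj, hs⟩) hφ, rfl⟩

variable [T2Space Y]

/-- The images of the edges at x₀ meet pairwise, so they form a star or a triangle. A triangle is
linearly dependent, whereas the edges at x₀ are independent. -/
theorem exists_center [FirstCountableTopology X] [Nonempty Y] (S : CRho X ≃ₗᵢ[ℂ] CRho Y) (x₀ : X) :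
    ∃ y₀ : Y, ∀ x, x ≠ x₀ → ∃ u a, MapsEdge S x x₀ u y₀ a := by
  have hedge : ∀ x z : X, x ≠ z → ∃ y w a, MapsEdge S x z y w a := fun x z hxz =>
    exists_evalDiff_comp S.toLinearIsometry hxz
  by_cases h1 : ∃ x₁, x₁ ≠ x₀
  swap
  · push Not at h1
    exact ⟨Classical.arbitrary Y, fun x hx => (hx (h1 x)).elim⟩
  obtain ⟨x₁, h10⟩ := h1
  by_cases h2 : ∃ x₂, x₂ ≠ x₀ ∧ x₂ ≠ x₁
  swap
  · push Not at h2
    obtain ⟨y, w, a, h⟩ := hedge x₁ x₀ h10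
    exact ⟨w, fun x hx => ⟨y, a, by rwa [h2 x hx]⟩⟩
  obtain ⟨x₂, h20, h21⟩ := h2
  have hcommon : ∀ {x x' : X} {y w y' w' : Y} {a a' : ℂ}, x ≠ x₀ → x' ≠ x₀ → x' ≠ x →
      MapsEdge S x x₀ y w a → MapsEdge S x' x₀ y' w' a' →
      y' = y ∨ w' = y ∨ y' = w ∨ w' = w := by
    intro x x' y w y' w' a a' hx hx' hxx h h'
    obtain ⟨p, q, b, hb⟩ := hedge x' x hxx
    exact exists_common_vertex (div_ne_zero hb.ne_zero h.ne_zero)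
      (div_ne_zero hb.ne_zero h'.ne_zero) (h.triangle h' hb) (h.ne hx) (h'.ne hx')
  obtain ⟨y₀, u₁, u₂, a₁, a₂, e₁, e₂⟩ : ∃ y₀ u₁ u₂ a₁ a₂,
      MapsEdge S x₁ x₀ u₁ y₀ a₁ ∧ MapsEdge S x₂ x₀ u₂ y₀ a₂ := by
    obtain ⟨y, w, a, h⟩ := hedge x₁ x₀ h10
    obtain ⟨y', w', a', h'⟩ := hedge x₂ x₀ h20
    rcases hcommon h10 h20 h21 h h' with rfl | rfl | rfl | rfl
    · exact ⟨_, _, _, _, _, h.swap_right, h'.swap_right⟩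
    · exact ⟨_, _, _, _, _, h.swap_right, h'⟩
    · exact ⟨_, _, _, _, _, h, h'.swap_right⟩
    · exact ⟨_, _, _, _, _, h, h'⟩
  refine ⟨y₀, fun x hx => ?_⟩
  by_cases hx1 : x = x₁
  · subst hx1; exact ⟨_, _, e₁⟩
  by_cases hx2 : x = x₂
  · subst hx2; exact ⟨_, _, e₂⟩
  obtain ⟨y, w, a, h⟩ := hedge x x₀ hx
  by_cases hy : y = y₀
  · subst hy; exact ⟨_, _, h.swap_right⟩
  by_cases hw : w = y₀
  · subst hw; exact ⟨_, _, h⟩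
  -- An edge missing y₀ must join u₁ and u₂. A bump at x vanishing at x₀, x₁, x₂ then has an image
  -- equal at y₀, u₁, u₂, although the edge at x does not vanish on it.
  exfalso
  have c1 : y = u₁ ∨ w = u₁ := by
    rcases hcommon h10 hx hx1 e₁ h with h | h | h | h <;> tauto
  have c2 : y = u₂ ∨ w = u₂ := by
    rcases hcommon h20 hx hx2 e₂ h with h | h | h | h <;> tauto
  obtain ⟨f, f1, f0⟩ := exists_complex_bump x {x₀, x₁, x₂} (Set.toFinite _)
  have d1 := e₁.2 (proj X f)
  have d2 := e₂.2 (proj X f)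
  have d := h.2 (proj X f)
  obtain ⟨F, hF⟩ := proj_surjective Y (S (proj X f))
  rw [← hF, evalDiff_proj, evalDiff_proj, f0 x₀ (by simp) (Ne.symm hx)] at d1 d2 d
  rw [f0 x₁ (by simp) (Ne.symm hx1)] at d1
  rw [f0 x₂ (by simp) (Ne.symm hx2)] at d2
  rw [f1] at d
  have hyw : F y = F y₀ ∧ F w = F y₀ := by
    have g1 : F u₁ = F y₀ := by linear_combination d1
    have g2 : F u₂ = F y₀ := by linear_combination d2
    have hne := h.ne hx
    have huu : u₁ ≠ u₂ := by
      rintro rfl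
      obtain ⟨k, k1, k0⟩ := exists_complex_bump x₁ {x₀, x₂} (Set.toFinite _)
      have b1 := e₁.2 (proj X k)
      have b2 := e₂.2 (proj X k)
      rw [b1, evalDiff_proj, evalDiff_proj, k1, k0 x₀ (by simp) h10.symm,
        k0 x₂ (by simp) h21] at b2
      apply e₁.ne_zero
      linear_combination b2
    rcases c1 with rfl | rfl <;> rcases c2 with rfl | rfl <;> first | exact (huu rfl).elim | exact ⟨‹_›, ‹_›⟩
  rw [hyw.1, hyw.2] at d
  apply h.ne_zero
  linear_combination -d

theorem exists_vertexMap [FirstCountableTopology X] [Nonempty X] [Nonempty Y]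
    (S : CRho X ≃ₗᵢ[ℂ] CRho Y) :
    ∃ (a : ℂ) (ψ : X → Y), ‖a‖ = 1 ∧
      ∀ x z e, evalDiff (ψ x) (ψ z) (S e) = a * evalDiff x z e := by
  obtain ⟨x₀⟩ := ‹Nonempty X›
  obtain ⟨y₀, h⟩ := exists_center S x₀
  choose! u a hua using h
  have ha : ∀ x x', x ≠ x₀ → x' ≠ x₀ → a x = a x' := by
    intro x x' hx hx'
    by_cases hxx : x' = x
    · rw [hxx]
    have h := hua x hx
    have h' := hua x' hx'
    obtain ⟨p, q, b, hb⟩ : ∃ p q b, MapsEdge S x' x p q b :=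
      exists_evalDiff_comp S.toLinearIsometry hxx
    have huu : u x ≠ u x' := by
      intro heq
      obtain ⟨k, k1, k0⟩ := exists_complex_bump x {x₀, x'} (Set.toFinite _)
      have b1 := h.2 (proj X k)
      have b2 := h'.2 (proj X k)
      rw [← heq, b1, evalDiff_proj, evalDiff_proj, k1, k0 x₀ (by simp) hx.symm,
        k0 x' (by simp) hxx] at b2
      apply h.ne_zero
      linear_combination b2
    have := eq_of_forall_sub_eq (div_ne_zero hb.ne_zero h.ne_zero)
      (div_ne_zero hb.ne_zero h'.ne_zero) (h.triangle h' hb) (h.ne hx) (h'.ne hx') huu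
    have hb0 := hb.ne_zero
    have ha0 := h.ne_zero
    have ha0' := h'.ne_zero
    field_simp at this
    exact this.symm
  obtain ⟨c, hc1, hc⟩ : ∃ c : ℂ, ‖c‖ = 1 ∧ ∀ x, x ≠ x₀ → a x = c := by
    by_cases hX : ∃ x, x ≠ x₀
    · obtain ⟨x, hx⟩ := hX
      exact ⟨a x, (hua x hx).1, fun x' hx' => ha x' x hx' hx⟩
    · push Not at hX
      -- On a one-point space no factor is determined, and 1 is a default.
      exact ⟨1, norm_one, fun x hx => (hx (hX x)).elim⟩
  classical
  have key : ∀ x e, evalDiff (if x = x₀ then y₀ else u x) y₀ (S e) = c * evalDiff x x₀ e := by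
    intro x e
    by_cases hx : x = x₀
    · subst hx
      obtain ⟨f, rfl⟩ := proj_surjective X e
      obtain ⟨F, hF⟩ := proj_surjective Y (S (proj X f))
      rw [← hF]
      simp
    · rw [if_neg hx, (hua x hx).2, hc x hx]
  refine ⟨c, fun x => if x = x₀ then y₀ else u x, hc1, fun x z e => ?_⟩
  rw [← evalDiff_sub_evalDiff _ _ y₀, key, key, ← evalDiff_sub_evalDiff x z x₀]
  ring

/-- The surjective linear isometries of the diameter norm are weighted composition operators. -/
theorem exists_homeomorph_of_linearIsometryEquiv [FirstCountableTopology Y] [Nonempty X]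
    [Nonempty Y] (S : CRho X ≃ₗᵢ[ℂ] CRho Y) :
    ∃ (c : ℂ) (φ : Y ≃ₜ X), ‖c‖ = 1 ∧
      ∀ f : C(X, ℂ), S (proj X f) = proj Y (c • f.comp (φ : C(Y, X))) := by
  obtain ⟨a, φ, ha, h⟩ := exists_vertexMap S.symm
  have ha0 : a ≠ 0 := by rintro rfl; simp at ha
  -- Because `S.symm` is used, the vertex map goes from Y to X. This identity makes f ∘ φ affine in
  -- F, and yields continuity, injectivity and surjectivity of φ.
  have key : ∀ (f : C(X, ℂ)) (F : C(Y, ℂ)), S (proj X f) = proj Y F →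
      ∀ y w, f (φ y) - f (φ w) = a * (F y - F w) := by
    intro f F hF y w
    rw [← evalDiff_proj, ← evalDiff_proj, ← h, ← hF, S.symm_apply_apply]
  obtain ⟨y₀⟩ := ‹Nonempty Y›
  have hcont : ∀ f : C(X, ℂ), Continuous fun y => f (φ y) := by
    intro f
    obtain ⟨F, hF⟩ := proj_surjective Y (S (proj X f))
    have : (fun y => f (φ y)) = fun y => a * (F y - F y₀) + f (φ y₀) := by
      funext y
      linear_combination key f F hF.symm y y₀
    rw [this]
    fun_prop
  obtain ⟨ψ, hψ⟩ : ∃ ψ : Y ≃ₜ X, ⇑ψ = φ := by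
    refine exists_homeomorph φ (fun f => ?_) (fun y w hyw => ?_) fun f hf x hx => ?_
    · exact Complex.continuous_re.comp (hcont (toComplex f))
    · by_contra hne
      obtain ⟨F, F1, F0⟩ := exists_complex_bump y {w} (Set.toFinite _)
      obtain ⟨e, he⟩ := S.surjective (proj Y F)
      obtain ⟨f, rfl⟩ := proj_surjective X e
      have := key f F he y w
      rw [hyw, F1, F0 w rfl (Ne.symm hne)] at this
      apply ha0
      linear_combination -this
    · obtain ⟨F, hF⟩ := proj_surjective Y (S (proj X (toComplex f)))
      have h0 : S (proj X (toComplex f)) = 0 := by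
        have hY : Nonempty Y := ⟨y₀⟩
        rw [← hF, ← map_zero (proj Y), proj_eq_iff_forall]
        intro y w
        have := key _ F hF.symm y w
        rw [toComplex_apply, toComplex_apply, hf, hf, sub_self, eq_comm, mul_eq_zero] at this
        simpa using this.resolve_left ha0
      rw [← map_zero S, S.injective.eq_iff, ← map_zero (proj X), proj_eq_iff_forall] at h0
      have := h0 x (φ y₀)
      simp [hf, hx] at this
  refine ⟨a⁻¹, ψ, by rw [norm_inv, ha, inv_one], fun f => ?_⟩
  obtain ⟨F, hF⟩ := proj_surjective Y (S (proj X f))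
  have hY : Nonempty Y := ⟨y₀⟩
  rw [← hF, proj_eq_iff_forall]
  intro y w
  have := key f F hF.symm y w
  simp only [ContinuousMap.smul_apply, ContinuousMap.comp_apply, ContinuousMap.coe_coe, hψ,
    smul_eq_mul]
  field_simp
  linear_combination -this

end Isometry

/-- Composition of a complex function with a real-linear functional. -/
noncomputable def compReal {X : Type*} [TopologicalSpace X] (L : ℂ →L[ℝ] ℝ) (k : C(X, ℂ)) : C(X, ℝ) :=
  ⟨fun x => L (k x), by fun_prop⟩

@[simp]
theorem compReal_apply {X : Type*} [TopologicalSpace X] (L : ℂ →L[ℝ] ℝ) (k : C(X, ℂ)) (x : X) : compReal L k x = L (k x) := rfl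

/-! ### From 2-local data to one weight and one homeomorphism -/

section TwoLocal

variable {X Y : Type*} [TopologicalSpace X] [CompactSpace X] [TopologicalSpace Y] [CompactSpace Y]

omit [TopologicalSpace X] [CompactSpace X] in
/-- The image of a graph of the square function over a set containing `0`, `1/2` and `1` in
`[0, 1]` under a non-trivial rotation is not a translate of this graph. -/
theorem eq_one_of_rotation_eq_translation {g : X → ℝ} (hg : ∀ x, g x ∈ Set.Icc (0 : ℝ) 1)
    {x₀ x₁ x₂ : X} (h0 : g x₀ = 0) (h1 : g x₁ = 1) (h2 : g x₂ = 1 / 2) (θ : X → X) {c a : ℂ}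
    (hc : ‖c‖ = 1)
    (h : ∀ x, c * (g x + (g x : ℂ) ^ 2 * Complex.I)
      = g (θ x) + (g (θ x) : ℂ) ^ 2 * Complex.I + a) : c = 1 := by
  have e0 := h x₀
  have e1 := h x₁
  have e2 := h x₂
  rw [h0] at e0
  rw [h1] at e1
  rw [h2] at e2
  obtain ⟨s0, s1⟩ := hg (θ x₀)
  obtain ⟨t0, t1⟩ := hg (θ x₁)
  obtain ⟨r0, r1⟩ := hg (θ x₂)
  generalize g (θ x₀) = s at *
  generalize g (θ x₁) = t at *
  generalize g (θ x₂) = r at *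
  obtain ⟨p, q⟩ := c
  obtain ⟨a, b⟩ := a
  have hpq : p ^ 2 + q ^ 2 = 1 := by
    have := Complex.sq_norm (⟨p, q⟩ : ℂ)
    rw [hc, Complex.normSq_mk] at this
    linarith
  rw [Complex.ext_iff] at e0 e1 e2 ⊢
  simp [pow_two] at e0 e1 e2 ⊢
  obtain ⟨e0r, e0i⟩ := e0
  obtain ⟨e1r, e1i⟩ := e1
  obtain ⟨e2r, e2i⟩ := e2
  have er : p - q = t - s := by linarith
  have ei : p + q = t * t - s * s := by linarith
  -- The rotated chord c(1 + i) has squared length 2, while each coordinate difference is at most 1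
  -- in modulus; hence t − s = ±1.
  have hsum : (t - s) ^ 2 + (t * t - s * s) ^ 2 = 2 := by
    rw [← er, ← ei]; linarith
  have b1 : (t - s) ^ 2 ≤ 1 := by nlinarith
  have b2 : (t * t - s * s) ^ 2 ≤ 1 := by
    have : |t * t - s * s| ≤ 1 := abs_le.2 ⟨by nlinarith, by nlinarith⟩
    exact (sq_le_one_iff_abs_le_one _).2 this
  have b3 : (t - s) ^ 2 = 1 := by linarith
  rcases mul_self_eq_one_iff.1 ((sq (t - s)).symm.trans b3) with h | h
  · have : t = 1 := by linarith
    have : s = 0 := by linarith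
    subst_vars
    constructor <;> linarith
  -- The half-turn swaps the ends of the arc, so only the point with g = 1/2 can exclude it.
  · exfalso
    have ht : t = 0 := by linarith
    have hs : s = 1 := by linarith
    subst ht hs
    have hp : p = -1 := by linarith
    have hq : q = 0 := by linarith
    subst hp hq
    have hr : r = 1 / 2 := by linarith
    subst hr
    norm_num at e2i e0i
    linarith

/-- A compact image cannot contain its own translate by a ≠ 0: at a maximum of Re(ā f) the translate
would exceed it by |a|². -/
theorem eq_zero_of_translate (f : C(X, ℂ)) {Z : Type*} [Nonempty Z] {φ ψ : Z → X}
    (hψ : Function.Surjective ψ) {a : ℂ} (h : ∀ z, f (φ z) = f (ψ z) + a) : a = 0 := by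
  have hX : Nonempty X := ‹Nonempty Z›.map φ
  have hc : Continuous fun x => (starRingEnd ℂ a * f x).re := by fun_prop
  obtain ⟨x, -, hx⟩ := isCompact_univ.exists_isMaxOn Set.univ_nonempty hc.continuousOn
  obtain ⟨z, rfl⟩ := hψ x
  have h1 : (starRingEnd ℂ a * f (φ z)).re ≤ (starRingEnd ℂ a * f (ψ z)).re :=
    hx (Set.mem_univ (φ z))
  rw [h, mul_add, Complex.add_re, mul_comm (starRingEnd ℂ a) a, Complex.mul_conj,
    Complex.ofReal_re] at h1
  exact Complex.normSq_eq_zero.1 (le_antisymm (by linarith) (Complex.normSq_nonneg a))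

/-- A map that agrees at any two functions with a weighted composition operator. -/
def IsTwoLocalComposition (T : CRho X → CRho Y) : Prop :=
  ∀ f g : C(X, ℂ), ∃ (c : ℂ) (φ : Y ≃ₜ X), ‖c‖ = 1 ∧
    T (proj X f) = proj Y (c • f.comp (φ : C(Y, X))) ∧
    T (proj X g) = proj Y (c • g.comp (φ : C(Y, X)))

theorem IsTwoLocalIsometry.isTwoLocalComposition [T2Space X] [T2Space Y]
    [FirstCountableTopology Y] [Nonempty X] [Nonempty Y] {T : CRho X → CRho Y}
    (hT : IsTwoLocalIsometry T) : IsTwoLocalComposition T := by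
  intro f g
  obtain ⟨S, hf, hg⟩ := hT (proj X f) (proj X g)
  obtain ⟨c, φ, hc, h⟩ := exists_homeomorph_of_linearIsometryEquiv S
  exact ⟨c, φ, hc, by rw [← hf, h], by rw [← hg, h]⟩

variable {T : CRho X → CRho Y}

/-- Pairing any f with the fixed function k = g + i g² forces the weight used for f to be that of k,
by rigidity of the arc. -/
theorem IsTwoLocalComposition.exists_weight [T2Space X] [Nonempty Y]
    (hT : IsTwoLocalComposition T) {x₀ x₁ x₂ : X} (h01 : x₀ ≠ x₁) (h02 : x₀ ≠ x₂) (h12 : x₁ ≠ x₂) :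
    ∃ c : ℂ, ‖c‖ = 1 ∧
      ∀ f, ∃ φ : Y ≃ₜ X, T (proj X f) = proj Y (c • f.comp (φ : C(Y, X))) := by
  obtain ⟨g, hg, g0, g1, g2⟩ : ∃ g : C(X, ℝ), (∀ x, g x ∈ Set.Icc (0 : ℝ) 1) ∧
      g x₀ = 0 ∧ g x₁ = 1 ∧ g x₂ = 1 / 2 := by
    obtain ⟨u, u1, u0, hu⟩ := exists_eq_one_eq_zero_on (x := x₁) (s := {x₀, x₂})
      (Set.toFinite _).isClosed (by simp [h01.symm, h12])
    obtain ⟨v, v1, v0, hv⟩ := exists_eq_one_eq_zero_on (x := x₂) (s := {x₀, x₁})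
      (Set.toFinite _).isClosed (by simp [h02.symm, h12.symm])
    refine ⟨u ⊔ (1 / 2 : ℝ) • v, fun x => ?_, ?_, ?_, ?_⟩
    · obtain ⟨a1, a2⟩ := hu x
      obtain ⟨b1, b2⟩ := hv x
      simp only [ContinuousMap.sup_apply, ContinuousMap.smul_apply, smul_eq_mul]
      exact ⟨le_sup_of_le_left a1, sup_le a2 (by linarith)⟩
    · simp [u0 x₀ (by simp), v0 x₀ (by simp)]
    · simp [u1, v0 x₁ (by simp)]
    · simp [u0 x₂ (by simp), v1]
  let k : C(X, ℂ) := ⟨fun x => g x + (g x : ℂ) ^ 2 * Complex.I, by fun_prop⟩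
  obtain ⟨c, φ₀, hc, hk, -⟩ := hT k k
  refine ⟨c, hc, fun f => ?_⟩
  obtain ⟨d, φ, hd, hkd, hf⟩ := hT k f
  rw [hk, proj_eq_iff] at hkd
  obtain ⟨a, ha⟩ := hkd
  have hd0 : d ≠ 0 := by rintro rfl; simp at hd
  have hcd : c / d = 1 := by
    refine eq_one_of_rotation_eq_translation hg g0 g1 g2 (fun x => φ (φ₀.symm x)) (a := a / d)
      (by rw [norm_div, hc, hd, div_one]) fun x => ?_
    have h1 := ha (φ₀.symm x)
    simp only [ContinuousMap.smul_apply, ContinuousMap.comp_apply, ContinuousMap.coe_coe,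
      smul_eq_mul, Homeomorph.apply_symm_apply] at h1
    change c * (g x + (g x : ℂ) ^ 2 * Complex.I) = d * (g (φ (φ₀.symm x)) +
      (g (φ (φ₀.symm x)) : ℂ) ^ 2 * Complex.I) + a at h1
    rw [div_mul_eq_mul_div, h1]
    field_simp
  rw [div_eq_one_iff_eq hd0] at hcd
  exact ⟨φ, by rw [hf, hcd]⟩

/-- Pairing k with L ∘ k gives a weight d that is a real multiple of c, because L ∘ k is real and
may be taken nonconstant. Real-linearity of L then makes the two sides agree up to a constant, which
vanishes by compactness. -/
theorem IsTwoLocalComposition.apply_compReal [Nonempty Y] (hT : IsTwoLocalComposition T) {c : ℂ}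
    (hc : ‖c‖ = 1) {k : C(X, ℂ)} {L : ℂ →L[ℝ] ℝ} {φ ψ : Y ≃ₜ X}
    (hφ : T (proj X k) = proj Y (c • k.comp (φ : C(Y, X))))
    (hψ : T (proj X (toComplex (compReal L k)))
      = proj Y (c • (toComplex (compReal L k)).comp (ψ : C(Y, X)))) (y : Y) :
    L (k (ψ y)) = L (k (φ y)) := by
  by_cases hconst : ∀ x x', L (k x) = L (k x')
  · exact hconst _ _
  push Not at hconst
  obtain ⟨x, x', hxx⟩ := hconst
  have hc0 : c ≠ 0 := by rintro rfl; simp at hc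
  obtain ⟨d, θ, -, h1, h2⟩ := hT k (toComplex (compReal L k))
  rw [hφ, proj_eq_iff] at h1
  rw [hψ, proj_eq_iff] at h2
  obtain ⟨a, ha⟩ := h1
  obtain ⟨b, hb⟩ := h2
  simp only [ContinuousMap.smul_apply, ContinuousMap.comp_apply, ContinuousMap.coe_coe,
    smul_eq_mul, toComplex_apply, compReal_apply] at ha hb
  obtain ⟨r, hr⟩ : ∃ r : ℝ, d = c * r := by
    have e1 := hb (θ.symm x)
    have e2 := hb (θ.symm x')
    rw [Homeomorph.apply_symm_apply] at e1 e2
    refine ⟨(L (k (ψ (θ.symm x))) - L (k (ψ (θ.symm x')))) / (L (k x) - L (k x')), ?_⟩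
    have hne : (L (k x) : ℂ) - L (k x') ≠ 0 := by
      rw [sub_ne_zero]; exact_mod_cast hxx
    push_cast
    field_simp
    linear_combination e2 - e1
  have ha' : ∀ y, k (φ y) = r • k (θ y) + a / c := by
    intro y
    have := ha y
    rw [hr] at this
    rw [Complex.real_smul]
    field_simp
    linear_combination this
  have hb' : ∀ y, (L (k (ψ y)) : ℂ) = L (k (φ y)) + (b / c - L (a / c)) := by
    intro y
    have := hb y
    rw [hr] at this
    rw [ha' y, map_add, map_smul, smul_eq_mul]
    push_cast
    field_simp
    linear_combination this
  have hz := eq_zero_of_translate (toComplex (compReal L k)) φ.surjective hb'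
  have := hb' y
  rw [hz, add_zero] at this
  exact_mod_cast this

/-- An additive functional on `C(X, ℝ)` that respects squares and takes each function to one of
its values is the evaluation at a point. -/
theorem exists_eq_eval (χ : C(X, ℝ) → ℝ) (hadd : ∀ f g, χ (f + g) = χ f + χ g)
    (hsq : ∀ f, χ (f * f) = χ f * χ f) (hrange : ∀ f, ∃ x, χ f = f x) :
    ∃ x, ∀ f, χ f = f x := by
  by_contra! hn
  choose h hh using hn
  have hconst : ∀ a : ℝ, χ (ContinuousMap.const X a) = a := fun a => by
    obtain ⟨x, hx⟩ := hrange (ContinuousMap.const X a)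
    simpa using hx
  -- If no point represents χ, each x has a witness h x. Finitely many of the squares (h x − χ(h
  -- x))² have a strictly positive sum, yet χ sends that sum to 0, which would be one of its values.
  let q : X → C(X, ℝ) := fun x => (h x + ContinuousMap.const X (-χ (h x))) *
    (h x + ContinuousMap.const X (-χ (h x)))
  have hq : ∀ x, χ (q x) = 0 := fun x => by
    rw [hsq, hadd, hconst]
    ring
  have hqx : ∀ x, 0 < q x x := fun x => by
    have : h x x - χ (h x) ≠ 0 := sub_ne_zero.2 (hh x).symm
    have := mul_self_pos.2 this
    simpa [q, sub_eq_add_neg] using this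
  have hq0 : ∀ x z, 0 ≤ q x z := fun x z => mul_self_nonneg _
  obtain ⟨t, ht⟩ := isCompact_univ.elim_finite_subcover (fun x => {z | 0 < q x z})
    (fun x => isOpen_lt continuous_const (q x).continuous)
    (fun x _ => Set.mem_iUnion.2 ⟨x, hqx x⟩)
  have hsum : χ (∑ x ∈ t, q x) = 0 := by
    let χ' : C(X, ℝ) →+ ℝ := AddMonoidHom.mk' χ hadd
    change χ' _ = 0
    rw [map_sum]
    exact Finset.sum_eq_zero fun x _ => hq x
  obtain ⟨z, hz⟩ := hrange (∑ x ∈ t, q x)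
  rw [hsum, ContinuousMap.sum_apply] at hz
  obtain ⟨x, hx, hxz⟩ := Set.mem_iUnion₂.1 (ht (Set.mem_univ z))
  have : 0 < ∑ x ∈ t, q x z := Finset.sum_pos' (fun x _ => hq0 x z) ⟨x, hx, hxz⟩
  linarith

theorem IsTwoLocalComposition.exists_homeomorph [T2Space X] [FirstCountableTopology X]
    [Nonempty Y] (hT : IsTwoLocalComposition T) {c : ℂ} (hc : ‖c‖ = 1)
    (h : ∀ f, ∃ φ : Y ≃ₜ X, T (proj X f) = proj Y (c • f.comp (φ : C(Y, X)))) :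
    ∃ φ : Y ≃ₜ X, ∀ f, T (proj X f) = proj Y (c • f.comp (φ : C(Y, X))) := by
  choose Φ hΦ using h
  have hlin : ∀ (L : ℂ →L[ℝ] ℝ) (k : C(X, ℂ)) (y : Y),
      L (k (Φ (toComplex (compReal L k)) y)) = L (k (Φ k y)) := fun L k y =>
    hT.apply_compReal hc (hΦ k) (hΦ _) y
  let B : C(X, ℝ) → Y → ℝ := fun f y => f (Φ (toComplex f) y)
  -- Packing f and g into f + i g makes one homeomorphism serve f, g and f + g; taking g = f * f
  -- handles squares.
  have hB : ∀ f g : C(X, ℝ), ∃ φ : Y ≃ₜ X, ∀ y, B f y = f (φ y) ∧ B g y = g (φ y) ∧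
      B (f + g) y = f (φ y) + g (φ y) := by
    intro f g
    let k : C(X, ℂ) := ⟨fun x => f x + g x * Complex.I, by fun_prop⟩
    have hk : ∀ x, k x = f x + g x * Complex.I := fun _ => rfl
    have e1 : compReal Complex.reCLM k = f := by ext x; simp [hk]
    have e2 : compReal Complex.imCLM k = g := by ext x; simp [hk]
    have e3 : compReal (Complex.reCLM + Complex.imCLM) k = f + g := by ext x; simp [hk]
    refine ⟨Φ k, fun y => ⟨?_, ?_, ?_⟩⟩
    · have := hlin Complex.reCLM k y
      rw [e1] at this
      simpa [hk] using this
    · have := hlin Complex.imCLM k y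
      rw [e2] at this
      simpa [hk] using this
    · have := hlin (Complex.reCLM + Complex.imCLM) k y
      rw [e3] at this
      simpa [hk, B] using this
  have hpt : ∀ y, ∃ x, ∀ f, B f y = f x := by
    intro y
    refine exists_eq_eval (fun f => B f y) (fun f g => ?_) (fun f => ?_) fun f => ⟨_, rfl⟩
    · obtain ⟨φ, hφ⟩ := hB f g
      obtain ⟨h1, h2, h3⟩ := hφ y
      rw [h1, h2, h3]
    · obtain ⟨φ, hφ⟩ := hB f (f * f)
      obtain ⟨h1, h2, -⟩ := hφ y
      rw [h1, h2, ContinuousMap.mul_apply]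
  choose ψ hψ using hpt
  have hcomp : ∀ f : C(X, ℝ), ∃ φ : Y ≃ₜ X, ∀ y, f (ψ y) = f (φ y) := fun f => by
    obtain ⟨φ, hφ⟩ := hB f f
    exact ⟨φ, fun y => by rw [← hψ, (hφ y).1]⟩
  obtain ⟨φ, hφ⟩ : ∃ φ : Y ≃ₜ X, ⇑φ = ψ := by
    refine DiameterNorm.exists_homeomorph ψ (fun f => ?_) (fun y w hyw => ?_) fun f hf x hx => ?_
    · obtain ⟨φ, hφ⟩ := hcomp f
      simp only [hφ]
      fun_prop
    -- For f peaking only at ψ y = ψ w, the homeomorphism attached to f sends both y and w to the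
    -- peak.
    · obtain ⟨f, f1, -, -⟩ := exists_peak (ψ y) isClosed_empty (by simp)
      obtain ⟨φ, hφ⟩ := hcomp f
      have h1 := (f1 (φ y)).1 (by rw [← hφ, f1])
      have h2 := (f1 (φ w)).1 (by rw [← hφ, f1, hyw])
      exact φ.injective (h1.trans h2.symm)
    · obtain ⟨φ, hφ⟩ := hcomp f
      have := hφ (φ.symm x)
      rw [hf, Homeomorph.apply_symm_apply, hx] at this
      exact zero_ne_one this
  refine ⟨φ, fun k => ?_⟩
  have hk : ∀ y, k (Φ k y) = k (φ y) := by
    intro y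
    rw [hφ]
    have e1 := (hlin Complex.reCLM k y).symm.trans (hψ y (compReal Complex.reCLM k))
    have e2 := (hlin Complex.imCLM k y).symm.trans (hψ y (compReal Complex.imCLM k))
    exact Complex.ext e1 e2
  rw [hΦ k]
  congr 2
  ext y
  exact hk y

end TwoLocal

/-! ### Low-dimensional case and the two conclusions -/

section Main

variable {X Y : Type*} [TopologicalSpace X] [CompactSpace X] [TopologicalSpace Y] [CompactSpace Y]

/-- On a space `C_ρ(X)` of dimension at most one a 2-local isometry is an isometry. -/
theorem IsTwoLocalIsometry.eq_linearIsometryEquiv {T : CRho X → CRho Y}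
    (hT : IsTwoLocalIsometry T) (e₀ : CRho X) (h : ∀ e : CRho X, ∃ a : ℂ, e = a • e₀) :
    ∃ S : CRho X ≃ₗᵢ[ℂ] CRho Y, ⇑S = T := by
  obtain ⟨S, hS, -⟩ := hT e₀ e₀
  refine ⟨S, funext fun e => ?_⟩
  obtain ⟨a, rfl⟩ := h e
  obtain ⟨S', h1, h2⟩ := hT e₀ (a • e₀)
  rw [← h2, map_smul, map_smul, h1, hS]

theorem exists_forall_eq_smul [T2Space X] [Nonempty X]
    (h : ¬∃ x₀ x₁ x₂ : X, x₀ ≠ x₁ ∧ x₀ ≠ x₂ ∧ x₁ ≠ x₂) :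
    ∃ e₀ : CRho X, ∀ e : CRho X, ∃ a : ℂ, e = a • e₀ := by
  push Not at h
  by_cases h2 : ∃ x z : X, x ≠ z
  · obtain ⟨x, z, hxz⟩ := h2
    obtain ⟨f, f1, f0⟩ := exists_complex_bump x {z} (Set.toFinite _)
    have fz := f0 z rfl hxz.symm
    refine ⟨proj X f, fun e => ?_⟩
    obtain ⟨g, rfl⟩ := proj_surjective X e
    refine ⟨g x - g z, ?_⟩
    rw [← map_smul, proj_eq_iff]
    refine ⟨g z, fun p => ?_⟩
    by_cases hp : x = p
    · subst hp; simp [f1]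
    · rw [← h x z p hxz hp]; simp [fz]
  · push Not at h2
    refine ⟨0, fun e => ⟨0, ?_⟩⟩
    obtain ⟨g, rfl⟩ := proj_surjective X e
    rw [smul_zero, ← map_zero (proj X), proj_eq_iff_forall]
    intro x z
    rw [h2 x z]
    simp

variable [T2Space X] [FirstCountableTopology X] [Nonempty X]
  [T2Space Y] [FirstCountableTopology Y] [Nonempty Y]

theorem IsTwoLocalIsometry.exists_weighted_composition {T : CRho X → CRho Y}
    (hT : IsTwoLocalIsometry T) :
    ∃ (c : ℂ) (φ : Y ≃ₜ X), ‖c‖ = 1 ∧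
      ∀ f : C(X, ℂ), T (proj X f) = proj Y (c • f.comp (φ : C(Y, X))) := by
  by_cases h : ∃ x₀ x₁ x₂ : X, x₀ ≠ x₁ ∧ x₀ ≠ x₂ ∧ x₁ ≠ x₂
  · obtain ⟨x₀, x₁, x₂, h01, h02, h12⟩ := h
    have hT' := hT.isTwoLocalComposition
    obtain ⟨c, hc, h⟩ := hT'.exists_weight h01 h02 h12
    obtain ⟨φ, hφ⟩ := hT'.exists_homeomorph hc h
    exact ⟨c, φ, hc, hφ⟩
  · obtain ⟨e₀, he₀⟩ := exists_forall_eq_smul h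
    obtain ⟨S, rfl⟩ := hT.eq_linearIsometryEquiv e₀ he₀
    exact exists_homeomorph_of_linearIsometryEquiv S

omit [T2Space X] [FirstCountableTopology X] [Nonempty X]
  [T2Space Y] [FirstCountableTopology Y] [Nonempty Y] in
theorem IsTwoLocalIsometry.exists_linearIsometryEquiv {T : CRho X → CRho Y}
    (hT : IsTwoLocalIsometry T) {c : ℂ} (hc : c ≠ 0) (φ : Y ≃ₜ X)
    (h : ∀ f : C(X, ℂ), T (proj X f) = proj Y (c • f.comp (φ : C(Y, X)))) :
    ∃ S : CRho X ≃ₗᵢ[ℂ] CRho Y, ⇑S = T := by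
  let T' : CRho X →ₗᵢ[ℂ] CRho Y :=
    { toFun := T
      map_add' := fun e u => by
        obtain ⟨f, rfl⟩ := proj_surjective X e
        obtain ⟨g, rfl⟩ := proj_surjective X u
        rw [← map_add, h, h, h, ← map_add, ContinuousMap.add_comp, smul_add]
      map_smul' := fun a e => by
        obtain ⟨S, h1, h2⟩ := hT e (a • e)
        rw [← h2, map_smul, h1, RingHom.id_apply]
      norm_map' := fun e => by
        obtain ⟨S, h1, -⟩ := hT e e
        change ‖T e‖ = ‖e‖
        rw [← h1, S.norm_map] }
  refine ⟨LinearIsometryEquiv.ofSurjective T' fun u => ?_, rfl⟩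
  obtain ⟨g, rfl⟩ := proj_surjective Y u
  refine ⟨proj X (c⁻¹ • g.comp (φ.symm : C(X, Y))), ?_⟩
  change T _ = _
  rw [h]
  congr 1
  ext y
  simp [hc]

omit [T2Space X] [FirstCountableTopology X] [Nonempty X]
  [T2Space Y] [FirstCountableTopology Y] [Nonempty Y] in
/-- A diameter-preserving linear bijection induces a surjective linear isometry. -/
theorem exists_linearIsometryEquiv_of_isDiameterPreserving (S : C(X, ℂ) ≃ₗ[ℂ] C(Y, ℂ))
    (hS : IsDiameterPreserving S) :
    ∃ R : CRho X ≃ₗᵢ[ℂ] CRho Y, ∀ f, R (proj X f) = proj Y (S f) := by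
  have hrho : ∀ f, rho (S f) = rho f := fun f => by
    have := hS f 0
    rwa [map_zero, sub_zero, sub_zero] at this
  let R : CRho X →ₗᵢ[ℂ] CRho Y :=
    { toLinearMap := (kerRho X).liftQ (proj Y ∘ₗ S.toLinearMap) fun f hf => by
        have hf : rho f = 0 := hf
        change proj Y (S f) = 0
        rw [← map_zero (proj Y), proj_eq_proj_iff, sub_zero, hrho, hf]
      norm_map' := fun e => by
        obtain ⟨f, rfl⟩ := proj_surjective X e
        exact hrho f }
  have hR : ∀ f, R (proj X f) = proj Y (S f) := fun f => rfl
  refine ⟨LinearIsometryEquiv.ofSurjective R fun u => ?_, hR⟩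
  obtain ⟨g, rfl⟩ := proj_surjective Y u
  exact ⟨proj X (S.symm g), by rw [hR, S.apply_symm_apply]⟩

omit [T2Space X] [FirstCountableTopology X] [Nonempty X]
  [T2Space Y] [FirstCountableTopology Y] [Nonempty Y] in
theorem IsTwoLocalDiameterPreserving.exists_isTwoLocalIsometry {Δ : C(X, ℂ) → C(Y, ℂ)}
    (hΔ : IsTwoLocalDiameterPreserving Δ) :
    ∃ T : CRho X → CRho Y, IsTwoLocalIsometry T ∧ ∀ f, T (proj X f) = proj Y (Δ f) := by
  choose s hs using proj_surjective X
  -- The linear S shared by two representatives preserves ρ of their difference, so the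
  -- representative is immaterial.
  have hT : ∀ f, proj Y (Δ (s (proj X f))) = proj Y (Δ f) := fun f => by
    obtain ⟨S, hS, h1, h2⟩ := hΔ (s (proj X f)) f
    rw [proj_eq_proj_iff, ← h1, ← h2, hS, ← proj_eq_proj_iff, hs]
  refine ⟨fun e => proj Y (Δ (s e)), fun e u => ?_, hT⟩
  obtain ⟨S, hS, h1, h2⟩ := hΔ (s e) (s u)
  obtain ⟨R, hR⟩ := exists_linearIsometryEquiv_of_isDiameterPreserving S hS
  exact ⟨R, by beta_reduce; rw [← h1, ← hR, hs], by beta_reduce; rw [← h2, ← hR, hs]⟩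

theorem IsTwoLocalDiameterPreserving.exists_weighted_composition {Δ : C(X, ℂ) → C(Y, ℂ)}
    (hΔ : IsTwoLocalDiameterPreserving Δ) :
    ∃ (c : ℂ) (φ : Y ≃ₜ X) (μ : C(X, ℂ) → ℂ), ‖c‖ = 1 ∧
      (∀ (a : ℂ) (f : C(X, ℂ)), μ (a • f) = a * μ f) ∧ μ 1 ≠ -c ∧
      ∀ f : C(X, ℂ), Δ f = c • f.comp (φ : C(Y, X)) + μ f • (1 : C(Y, ℂ)) := by
  obtain ⟨T, hT, hTΔ⟩ := hΔ.exists_isTwoLocalIsometry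
  obtain ⟨c, φ, hc, h⟩ := hT.exists_weighted_composition
  have hμ : ∀ f, ∃ a : ℂ, ∀ y, Δ f y = (c • f.comp (φ : C(Y, X))) y + a := fun f => by
    rw [← proj_eq_iff, ← hTΔ, h]
  choose μ hμ using hμ
  obtain ⟨y⟩ := ‹Nonempty Y›
  refine ⟨c, φ, μ, hc, fun a f => ?_, fun h1 => ?_, fun f => ?_⟩
  · obtain ⟨S, -, h1, h2⟩ := hΔ f (a • f)
    have e : Δ (a • f) = a • Δ f := by rw [← h1, ← h2, map_smul]
    have e1 := hμ (a • f) y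
    rw [e, ContinuousMap.smul_apply, hμ f y] at e1
    simp only [ContinuousMap.smul_apply, ContinuousMap.comp_apply, smul_eq_mul] at e1
    linear_combination -e1
  -- μ(1) = −c would give Δ(1) = 0, against injectivity of S.
  · obtain ⟨S, -, hS, -⟩ := hΔ 1 1
    have e : S 1 = 0 := by
      rw [hS]
      ext y
      rw [hμ, h1]
      simp
    rw [map_eq_zero_iff S S.injective] at e
    have := congrArg (fun f : C(X, ℂ) => f (φ y)) e
    simp at this
  · ext y
    rw [hμ]
    simp

end Main

end DiameterNorm

theorem theorem2 {X Y : Type*}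
    [TopologicalSpace X] [CompactSpace X] [T2Space X] [FirstCountableTopology X] [Nonempty X]
    [TopologicalSpace Y] [CompactSpace Y] [T2Space Y] [FirstCountableTopology Y] [Nonempty Y] :
    (∀ T : DiameterNorm.CRho X → DiameterNorm.CRho Y, DiameterNorm.IsTwoLocalIsometry T →
      (∃ S : DiameterNorm.CRho X ≃ₗᵢ[ℂ] DiameterNorm.CRho Y, ⇑S = T) ∧
      ∃ (c : ℂ) (φ : Y ≃ₜ X), ‖c‖ = 1 ∧
        ∀ f : C(X, ℂ),
          T (DiameterNorm.proj X f) = DiameterNorm.proj Y (c • f.comp (φ : C(Y, X)))) ∧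
    (∀ Δ : C(X, ℂ) → C(Y, ℂ), DiameterNorm.IsTwoLocalDiameterPreserving Δ →
      ∃ (c : ℂ) (φ : Y ≃ₜ X) (μ : C(X, ℂ) → ℂ), ‖c‖ = 1 ∧
        (∀ (a : ℂ) (f : C(X, ℂ)), μ (a • f) = a * μ f) ∧ μ 1 ≠ -c ∧
        ∀ f : C(X, ℂ), Δ f = c • f.comp (φ : C(Y, X)) + μ f • (1 : C(Y, ℂ))) := by
  refine ⟨fun T hT => ?_, fun Δ hΔ => hΔ.exists_weighted_composition⟩
  obtain ⟨c, φ, hc, h⟩ := hT.exists_weighted_composition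
  exact ⟨hT.exists_linearIsometryEquiv (norm_ne_zero_iff.1 (by simp [hc])) φ h, c, φ, hc, h⟩
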